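/- For a complex $n\times n$ matrix $A=(a_{ij})$ let $\overline{A}=(\overline{a_{ij}})$ be its entrywise conjugate, let $A_{\mathbb{R}}=\frac12(A+\overline{A})$ be its entrywise real part, and let $|A|=(A^*A)^{1/2}$ be its absolute value. For positive semidefinite $X,Y\in\mathbb{M}_n(\mathbb{C})$ with eigenvalues $\lambda_1(X)\ge\dots\ge\lambda_n(X)$ and $\lambda_1(Y)\ge\dots\ge\lambda_n(Y)$, listed with multiplicity, $X$ is said to be weakly log-majorised by $Y$, written $X\prec_{w\log}Y$, if $\prod_{j=1}^k\lambda_j(X)\le\prod_{j=1}^k\lambda_j(Y)$ for all $k=1,\dots,n$. If $A\in\mathbb{M}_n(\mathbb{C})$ is normal, then $|A_{\mathbb{R}}|$ and $|A|_{\mathbb{R}}$ are positive semidefinite and $$|A_{\mathbb{R}}|\prec_{w\log}|A|_{\mathbb{R}}.$$ In particular, $\det|A|_{\mathbb{R}}$ is a nonnegative real number and $|\det A_{\mathbb{R}}|\le\det|A|_{\mathbb{R}}$. -/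

import Mathlib

open scoped MatrixOrder ComplexOrder Matrix.Norms.L2Operator

/-- The entrywise real part `A_ℝ = (A + conj A) / 2` of a complex matrix, as a complex matrix;
`A.map star` is the entrywise complex conjugate of `A`. -/
noncomputable def entrywiseRealPart {ι : Type*} (A : Matrix ι ι ℂ) : Matrix ι ι ℂ :=
  (2⁻¹ : ℂ) • (A + A.map star)

/-- The absolute value `|A| = (A* A)^(1/2)`, through the positive semidefinite square root. -/
noncomputable def matrixAbs {ι : Type*} [Fintype ι] [DecidableEq ι] (A : Matrix ι ι ℂ) :
    Matrix ι ι ℂ :=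
  CFC.abs A

/-- Weak log-majorisation `X ≺_wlog Y`, a relation between positive semidefinite matrices: for
every `k`, the product of the `k` largest eigenvalues of `X` is at most the product of the `k`
largest eigenvalues of `Y`. Here `eigenvalues₀` lists the eigenvalues, with multiplicity, in
decreasing order. -/
def WeakLogMajorisedBy {ι : Type*} [Fintype ι] [DecidableEq ι] (X Y : Matrix ι ι ℂ) : Prop :=
  ∃ (hX : X.PosSemidef) (hY : Y.PosSemidef), ∀ k : ℕ, 1 ≤ k → k ≤ Fintype.card ι →
    ∏ j : Fin (Fintype.card ι) with j.val < k, hX.isHermitian.eigenvalues₀ j ≤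
      ∏ j : Fin (Fintype.card ι) with j.val < k, hY.isHermitian.eigenvalues₀ j

/-! For normal `A`, the functional calculus gives `S = |A|^(1/2)` and `T` with `SᴴS = TᴴT = |A|` and
`SᴴT = A`. Stacking `S` and `T` over their conjugates averages these identities: with `P = |A|_ℝ`
and `B = A_ℝ` there are `F`, `G` such that `FᴴF = GᴴG = P` and `FᴴG = B`.

Let `V` span the top `k` eigenvectors of `|B|`, and let `s`, `t` be the top-`k` eigenvalue products
of `|B|` and `P`. Cauchy–Schwarz for the Gram determinants of `FBV` and `GV` (from Cauchy–Binet),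
with the determinantal Rayleigh bound for `P`, gives `s⁴ ≤ (t s²) t`, hence `s ≤ t`. -/

namespace Matrix

section CauchyBinet

variable {κ m R : Type*} [Fintype κ] [DecidableEq κ] [Fintype m] [CommRing R]

/-- Expansion of the determinant of a product along the rows of the second factor. -/
theorem det_mul_eq_sum_prod (M : Matrix κ m R) (N : Matrix m κ R) :
    (M * N).det = ∑ f : κ → m, (∏ i, M i (f i)) * (N.submatrix f id).det := by
  classical
  have h : M * N = fun i => ∑ j, M i j • N j := by
    ext i j
    simp [mul_apply, Finset.sum_apply]
  change detRowAlternating (M * N) = _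
  rw [h, ← AlternatingMap.coe_multilinearMap, MultilinearMap.map_sum]
  refine Finset.sum_congr rfl fun f _ => ?_
  rw [MultilinearMap.map_smul_univ (detRowAlternating (n := κ) (R := R)).toMultilinearMap
    (fun i => M i (f i)) (fun i => N (f i))]
  rfl

/-- The **Cauchy–Binet formula**, summed over all functions instead of over subsets. -/
theorem factorial_card_mul_det_mul (M : Matrix κ m R) (N : Matrix m κ R) :
    ((Fintype.card κ).factorial : R) * (M * N).det =
      ∑ f : κ → m, (M.submatrix id f).det * (N.submatrix f id).det := by
  -- Substituting `f ∘ σ` for `f` absorbs the sign into the row-permuted minor, so each `σ`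
  -- contributes the same amount.
  have h (σ : Equiv.Perm κ) : ∑ f : κ → m,
      ((Equiv.Perm.sign σ : ℤ) : R) * (∏ i, M i (f (σ i))) * (N.submatrix f id).det =
        (M * N).det := by
    rw [det_mul_eq_sum_prod]
    refine Fintype.sum_equiv (σ.symm.arrowCongr (Equiv.refl m)) _ _ fun f => ?_
    have h1 : σ.symm.arrowCongr (Equiv.refl m) f = f ∘ σ := rfl
    have h2 : N.submatrix (f ∘ σ) id = (N.submatrix f id).submatrix σ id := rfl
    rw [h1, h2, det_permute]
    simp only [Function.comp_apply]
    ring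
  have hdet (f : κ → m) : (M.submatrix id f).det =
      ∑ σ : Equiv.Perm κ, ((Equiv.Perm.sign σ : ℤ) : R) * ∏ i, M i (f (σ i)) := by
    rw [← det_transpose, det_apply']
    rfl
  simp only [hdet, Finset.sum_mul]
  rw [Finset.sum_comm, Finset.sum_congr rfl fun σ _ => h σ]
  simp [Fintype.card_perm]

end CauchyBinet

/-! ### Gram determinants -/

section Gram

variable {κ m : Type*} [Fintype κ] [DecidableEq κ]

theorem det_conjTranspose_submatrix (F : Matrix m κ ℂ) (f : κ → m) :
    (Fᴴ.submatrix id f).det = star (F.submatrix f id).det := by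
  rw [← det_conjTranspose, conjTranspose_submatrix]

variable [Fintype m]

theorem factorial_card_mul_re_det_conjTranspose_mul_self (F : Matrix m κ ℂ) :
    ((Fintype.card κ).factorial : ℝ) * (Fᴴ * F).det.re =
      ∑ f : κ → m, ‖(F.submatrix f id).det‖ ^ 2 := by
  have h := congrArg Complex.re (factorial_card_mul_det_mul Fᴴ F)
  rw [← Complex.ofReal_natCast, Complex.re_ofReal_mul] at h
  rw [h, Complex.re_sum]
  refine Finset.sum_congr rfl fun f _ => ?_
  rw [det_conjTranspose_submatrix, Complex.star_def, ← Complex.normSq_eq_conj_mul_self,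
    Complex.normSq_eq_norm_sq, Complex.ofReal_re]

/-- The **Cauchy–Schwarz inequality** for Gram determinants. -/
theorem norm_det_conjTranspose_mul_sq_le (F G : Matrix m κ ℂ) :
    ‖(Fᴴ * G).det‖ ^ 2 ≤ (Fᴴ * F).det.re * (Gᴴ * G).det.re := by
  have hc : (0 : ℝ) < (Fintype.card κ).factorial := by exact_mod_cast Nat.factorial_pos _
  refine le_of_mul_le_mul_left ?_ (pow_pos hc 2)
  have h := congrArg norm (factorial_card_mul_det_mul Fᴴ G)
  rw [norm_mul, Complex.norm_natCast] at h
  calc _ = (((Fintype.card κ).factorial : ℝ) * ‖(Fᴴ * G).det‖) ^ 2 := by ring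
    _ ≤ (∑ f : κ → m, ‖(F.submatrix f id).det‖ * ‖(G.submatrix f id).det‖) ^ 2 := by
      rw [h]
      gcongr
      refine (norm_sum_le _ _).trans_eq (Finset.sum_congr rfl fun f _ => ?_)
      rw [norm_mul, det_conjTranspose_submatrix, norm_star]
    _ ≤ _ := Finset.sum_mul_sq_le_sq_mul_sq _ _ _
    _ = _ := by
      rw [← factorial_card_mul_re_det_conjTranspose_mul_self,
        ← factorial_card_mul_re_det_conjTranspose_mul_self]
      ring

theorem re_det_conjTranspose_mul_self_nonneg (F : Matrix m κ ℂ) : 0 ≤ (Fᴴ * F).det.re :=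
  (Complex.le_def.mp (posSemidef_conjTranspose_mul_self F).det_nonneg).1

/-- A determinantal Rayleigh quotient of a diagonal matrix is bounded by the largest product
of diagonal entries at distinct indices. -/
theorem re_det_conjTranspose_diagonal_mul_le [DecidableEq m] (d : m → ℝ) (W : Matrix m κ ℂ) {t : ℝ}
    (ht : ∀ f : κ → m, Function.Injective f → ∏ i, d (f i) ≤ t) :
    (Wᴴ * diagonal (fun i => (d i : ℂ)) * W).det.re ≤ t * (Wᴴ * W).det.re := by
  have hc : (0 : ℝ) < (Fintype.card κ).factorial := by exact_mod_cast Nat.factorial_pos _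
  refine le_of_mul_le_mul_left ?_ hc
  have h := congrArg Complex.re
    (factorial_card_mul_det_mul (Wᴴ * diagonal (fun i => (d i : ℂ))) W)
  rw [← Complex.ofReal_natCast, Complex.re_ofReal_mul] at h
  rw [h, mul_left_comm, factorial_card_mul_re_det_conjTranspose_mul_self, Complex.re_sum,
    Finset.mul_sum]
  refine Finset.sum_le_sum fun f _ => ?_
  have h1 : (Wᴴ * diagonal (fun i => (d i : ℂ))).submatrix id f =
      Wᴴ.submatrix id f * diagonal (fun i => (d (f i) : ℂ)) := by
    ext i j
    simp
  have h2 : ((Wᴴ * diagonal (fun i => (d i : ℂ))).submatrix id f).det * (W.submatrix f id).det =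
      ((∏ i, d (f i)) * ‖(W.submatrix f id).det‖ ^ 2 : ℝ) := by
    rw [h1, det_mul, det_diagonal, det_conjTranspose_submatrix, ← Complex.normSq_eq_norm_sq]
    push_cast
    rw [Complex.normSq_eq_conj_mul_self, Complex.star_def]
    ring
  rw [h2, Complex.ofReal_re]
  -- A non-injective `f` repeats a row, so its minor vanishes and `ht` is not needed there.
  by_cases hf : Function.Injective f
  · gcongr
    exact ht f hf
  · obtain ⟨i, j, hij, hne⟩ : ∃ i j, f i = f j ∧ i ≠ j := by
      simpa [Function.Injective] using hf
    have : (W.submatrix f id).det = 0 := det_zero_of_row_eq hne (by ext; simp [hij])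
    simp [this]

end Gram

/-! ### Products of the largest eigenvalues -/

section Eigenvalues

/-- Once the image of `f` is sorted, its `i`-th index is at least `i`, and `d` is decreasing. -/
theorem prod_comp_injective_le_prod_castLE {k N : ℕ} (hk : k ≤ N) {d : Fin N → ℝ} (hd : Antitone d)
    (h0 : ∀ i, 0 ≤ d i) {f : Fin k → Fin N} (hf : Function.Injective f) :
    ∏ i, d (f i) ≤ ∏ i, d (Fin.castLE hk i) := by
  have hcard : (Finset.univ.map ⟨f, hf⟩).card = k := by simp
  have h : ∏ i, d (f i) = ∏ i, d ((Finset.univ.map ⟨f, hf⟩).orderEmbOfFin hcard i) := by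
    have h1 : ∏ i, d (f i) = ∏ j ∈ Finset.univ.map ⟨f, hf⟩, d j :=
      (Finset.prod_map Finset.univ ⟨f, hf⟩ d).symm
    rw [h1]
    conv_lhs => rw [← Finset.map_orderEmbOfFin_univ _ hcard, Finset.prod_map]
    rfl
  rw [h]
  refine Finset.prod_le_prod (fun i _ => h0 _) fun i _ => hd ?_
  have hmono := ((Finset.univ.map ⟨f, hf⟩).orderEmbOfFin hcard).strictMono
  obtain ⟨i, hi⟩ := i
  induction i with
  | zero => exact Fin.le_def.mpr (Nat.zero_le _)
  | succ i ih =>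
    have h1 := Fin.le_def.mp (ih (by omega) (Finset.mem_univ _))
    have h2 := Fin.lt_def.mp (hmono (show (⟨i, by omega⟩ : Fin k) < ⟨i + 1, hi⟩ from by simp))
    simp only [Fin.le_def, Fin.val_castLE] at h1 h2 ⊢
    omega

theorem prod_filter_val_lt_eq_prod_castLE {k N : ℕ} (hk : k ≤ N) (d : Fin N → ℝ) :
    ∏ j : Fin N with j.val < k, d j = ∏ i, d (Fin.castLE hk i) := by
  symm
  refine Finset.prod_bij (fun i _ => Fin.castLE hk i) (by simp) (by simp) ?_ (by simp)
  intro j hj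
  exact ⟨⟨j, by simpa using hj⟩, by simp, rfl⟩

variable {n : Type*} [Fintype n] [DecidableEq n]

theorem PosSemidef.eigenvalues₀_nonneg {P : Matrix n n ℂ} (hP : P.PosSemidef)
    (j : Fin (Fintype.card n)) : 0 ≤ hP.isHermitian.eigenvalues₀ j := by
  simpa [IsHermitian.eigenvalues] using
    hP.eigenvalues_nonneg ((Fintype.equivOfCardEq (Fintype.card_fin _)) j)

theorem PosSemidef.re_det_conjTranspose_mul_mul_le {P : Matrix n n ℂ} (hP : P.PosSemidef) {k : ℕ}
    (hk : k ≤ Fintype.card n) (U : Matrix n (Fin k) ℂ) :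
    (Uᴴ * P * U).det.re ≤
      (∏ i, hP.isHermitian.eigenvalues₀ (Fin.castLE hk i)) * (Uᴴ * U).det.re := by
  set Q : Matrix n n ℂ := hP.isHermitian.eigenvectorUnitary.1
  have hQQ : Q * Qᴴ = 1 := Unitary.mul_star_self_of_mem hP.isHermitian.eigenvectorUnitary.2
  have hPQ : P = Q * diagonal (fun i => (hP.isHermitian.eigenvalues i : ℂ)) * Qᴴ :=
    hP.isHermitian.spectral_theorem
  have h := re_det_conjTranspose_diagonal_mul_le hP.isHermitian.eigenvalues (Qᴴ * U)
    (t := ∏ i, hP.isHermitian.eigenvalues₀ (Fin.castLE hk i)) fun f hf => by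
      exact prod_comp_injective_le_prod_castLE hk hP.isHermitian.eigenvalues₀_antitone
        hP.eigenvalues₀_nonneg ((Equiv.injective _).comp hf)
  have h1 : (Qᴴ * U)ᴴ * (Qᴴ * U) = Uᴴ * U := by
    rw [conjTranspose_mul, conjTranspose_conjTranspose, Matrix.mul_assoc, ← Matrix.mul_assoc Q,
      hQQ, Matrix.one_mul]
  have h2 : (Qᴴ * U)ᴴ * diagonal (fun i => (hP.isHermitian.eigenvalues i : ℂ)) * (Qᴴ * U) =
      Uᴴ * P * U := by
    conv_rhs => rw [hPQ]
    simp only [conjTranspose_mul, conjTranspose_conjTranspose, Matrix.mul_assoc]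
  rwa [h1, h2] at h

/-- Compression of a Hermitian matrix to the span of the first `k` eigenvectors. -/
theorem IsHermitian.exists_isometry_conj_mul_self {H : Matrix n n ℂ} (hH : H.IsHermitian) {k : ℕ}
    (hk : k ≤ Fintype.card n) : ∃ V : Matrix n (Fin k) ℂ, Vᴴ * V = 1 ∧
      Vᴴ * (H * H) * V = diagonal (fun i => ((hH.eigenvalues₀ (Fin.castLE hk i) ^ 2 : ℝ) : ℂ)) := by
  set Q : Matrix n n ℂ := hH.eigenvectorUnitary.1
  have hQQ : Qᴴ * Q = 1 := Unitary.star_mul_self_of_mem hH.eigenvectorUnitary.2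
  have hHQ : H = Q * diagonal (fun i => (hH.eigenvalues i : ℂ)) * Qᴴ := hH.spectral_theorem
  let e : Fin (Fintype.card n) ≃ n := Fintype.equivOfCardEq (Fintype.card_fin _)
  let g : Fin k → n := fun i => e (Fin.castLE hk i)
  have hg : Function.Injective g := e.injective.comp (Fin.castLE_injective hk)
  have hsub (M : Matrix n n ℂ) :
      (Q.submatrix id g)ᴴ * M * Q.submatrix id g = (Qᴴ * M * Q).submatrix g g := by
    ext i j
    simp [mul_apply]
  have hHH : Qᴴ * (H * H) * Q = diagonal (fun i => ((hH.eigenvalues i ^ 2 : ℝ) : ℂ)) := by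
    set D := diagonal (fun i => (hH.eigenvalues i : ℂ))
    calc Qᴴ * (H * H) * Q = (Qᴴ * Q) * D * (Qᴴ * Q) * D * (Qᴴ * Q) := by
          rw [hHQ]; simp only [Matrix.mul_assoc]
      _ = D * D := by simp [hQQ]
      _ = _ := by simp [D, sq]
  refine ⟨Q.submatrix id g, ?_, ?_⟩
  · have := hsub 1
    rwa [Matrix.mul_one, Matrix.mul_one, hQQ, submatrix_one _ hg] at this
  · rw [hsub, hHH, submatrix_diagonal _ _ hg]
    congr 1
    ext i
    simp [IsHermitian.eigenvalues, g, e]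

end Eigenvalues

end Matrix

open Matrix

/-! ### Gram factorisations and log-majorisation -/

section Main

variable {m n : Type*} [Fintype m] [Fintype n]

/-- Entrywise conjugation is multiplicative and commutes with the adjoint, so stacking `X` over its
conjugate, scaled by `1/√2`, turns products `XᴴY` into their entrywise real parts. -/
theorem exists_gram_entrywiseRealPart {A P S T : Matrix n n ℂ} (hS : Sᴴ * S = P) (hT : Tᴴ * T = P)
    (hST : Sᴴ * T = A) : ∃ F G : Matrix (n ⊕ n) n ℂ, Fᴴ * F = entrywiseRealPart P ∧
      Gᴴ * G = entrywiseRealPart P ∧ Fᴴ * G = entrywiseRealPart A := by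
  let c : ℂ := ((√2)⁻¹ : ℝ)
  have hc : star c * c = 2⁻¹ := by
    simp only [c, Complex.star_def, Complex.conj_ofReal, ← Complex.ofReal_mul]
    rw [← mul_inv, Real.mul_self_sqrt (by norm_num)]
    simp
  have key (X Y : Matrix n n ℂ) : (c • fromRows X (X.map star))ᴴ * (c • fromRows Y (Y.map star)) =
      entrywiseRealPart (Xᴴ * Y) := by
    have : (X.map star)ᴴ * Y.map star = (Xᴴ * Y).map star := by
      ext i j
      simp [mul_apply]
    rw [conjTranspose_smul, Matrix.smul_mul, Matrix.mul_smul, smul_smul, hc,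
      conjTranspose_fromRows_eq_fromCols_conjTranspose, fromCols_mul_fromRows, this,
      entrywiseRealPart]
  refine ⟨c • fromRows S (S.map star), c • fromRows T (T.map star), ?_, ?_, ?_⟩ <;> rw [key]
  · rw [hS]
  · rw [hT]
  · rw [hST]

variable [DecidableEq n]

/-- If `[[P, B], [Bᴴ, P]]` is a Gram matrix then `|B|` is weakly log-majorised by `P`. -/
theorem weakLogMajorisedBy_of_gram {P B : Matrix n n ℂ} {F G : Matrix m n ℂ} (hF : Fᴴ * F = P)
    (hG : Gᴴ * G = P) (hFG : Fᴴ * G = B) : WeakLogMajorisedBy (matrixAbs B) P := by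
  have hX : (matrixAbs B).PosSemidef := nonneg_iff_posSemidef.mp (CFC.abs_nonneg B)
  have hP : P.PosSemidef := hF ▸ posSemidef_conjTranspose_mul_self F
  refine ⟨hX, hP, fun k _ hk => ?_⟩
  rw [prod_filter_val_lt_eq_prod_castLE hk, prod_filter_val_lt_eq_prod_castLE hk]
  obtain ⟨V, hV, hHV⟩ := hX.isHermitian.exists_isometry_conj_mul_self hk
  have hBB : matrixAbs B * matrixAbs B = Bᴴ * B := CFC.abs_mul_abs B
  rw [hBB] at hHV
  set s := ∏ i, hX.isHermitian.eigenvalues₀ (Fin.castLE hk i) with hs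
  set t := ∏ i, hP.isHermitian.eigenvalues₀ (Fin.castLE hk i) with ht
  have hs0 : 0 ≤ s := Finset.prod_nonneg fun i _ => hX.eigenvalues₀_nonneg _
  have ht0 : 0 ≤ t := Finset.prod_nonneg fun i _ => hP.eigenvalues₀_nonneg _
  have hd : (Vᴴ * (Bᴴ * B) * V).det = ((s ^ 2 : ℝ) : ℂ) := by
    rw [hHV, det_diagonal, hs, ← Finset.prod_pow]
    push_cast
    rfl
  -- The extra factor `B` makes the mixed Gram matrix `VᴴBᴴBV`, whose determinant is `s²`.
  have h := norm_det_conjTranspose_mul_sq_le (F * (B * V)) (G * V)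
  have e1 : (F * (B * V))ᴴ * (G * V) = Vᴴ * (Bᴴ * B) * V := by
    rw [← hFG]
    simp only [conjTranspose_mul, Matrix.mul_assoc]
  have e2 : (F * (B * V))ᴴ * (F * (B * V)) = (B * V)ᴴ * P * (B * V) := by
    rw [← hF]
    simp only [conjTranspose_mul, Matrix.mul_assoc]
  have e3 : (G * V)ᴴ * (G * V) = Vᴴ * P * V := by
    rw [← hG]
    simp only [conjTranspose_mul, Matrix.mul_assoc]
  have e4 : (B * V)ᴴ * (B * V) = Vᴴ * (Bᴴ * B) * V := by
    simp only [conjTranspose_mul, Matrix.mul_assoc]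
  have h1 := hP.re_det_conjTranspose_mul_mul_le hk (B * V)
  have h2 := hP.re_det_conjTranspose_mul_mul_le hk V
  have h3 := re_det_conjTranspose_mul_self_nonneg (G * V)
  rw [e4, hd, Complex.ofReal_re] at h1
  rw [hV, det_one, Complex.one_re, mul_one] at h2
  rw [e3] at h3
  rw [e1, e2, e3, hd, Complex.norm_real, Real.norm_of_nonneg (sq_nonneg s)] at h
  have h4 : (s ^ 2) ^ 2 ≤ t * s ^ 2 * t :=
    h.trans (mul_le_mul h1 h2 h3 (mul_nonneg ht0 (sq_nonneg s)))
  rcases hs0.eq_or_lt with h0 | h0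
  · rwa [← h0]
  · have h5 : s ^ 2 ≤ t ^ 2 := le_of_mul_le_mul_left (by linarith) (pow_pos h0 2)
    exact le_of_sq_le_sq h5 ht0

theorem norm_det_le_det_of_gram {P B : Matrix n n ℂ} {F G : Matrix m n ℂ} (hF : Fᴴ * F = P)
    (hG : Gᴴ * G = P) (hFG : Fᴴ * G = B) : ((‖B.det‖ : ℝ) : ℂ) ≤ P.det := by
  have hP : P.PosSemidef := hF ▸ posSemidef_conjTranspose_mul_self F
  have h0 := Complex.le_def.mp hP.det_nonneg
  have h := norm_det_conjTranspose_mul_sq_le F G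
  rw [hF, hG, hFG, ← sq] at h
  exact Complex.le_def.mpr ⟨le_of_sq_le_sq h h0.1, h0.2⟩

/-- A normal matrix and its absolute value have a common factorisation. -/
theorem exists_factorisation_of_isStarNormal (A : Matrix n n ℂ) (hA : IsStarNormal A) :
    ∃ S T : Matrix n n ℂ, Sᴴ * S = matrixAbs A ∧ Tᴴ * T = matrixAbs A ∧ Sᴴ * T = A := by
  have hc (f : ℂ → ℂ) : ContinuousOn f (spectrum ℂ A) := (Matrix.finite_spectrum A).continuousOn f
  have habs : matrixAbs A = cfc (fun z : ℂ => (‖z‖ : ℂ)) A := by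
    rw [matrixAbs, CFC.abs_eq_cfcₙ_coe_norm ℂ A, cfcₙ_eq_cfc]
    rfl
  -- The convention `0 / 0 = 0` covers singular `A`.
  refine ⟨cfc (fun z : ℂ => (√‖z‖ : ℂ)) A, cfc (fun z : ℂ => z / (√‖z‖ : ℂ)) A, ?_, ?_, ?_⟩
  all_goals
    rw [← star_eq_conjTranspose, ← cfc_star, ← cfc_mul _ _ _ (hc _) (hc _)]
  · rw [habs]
    refine cfc_congr fun z _ => ?_
    simp [← Complex.ofReal_mul]
  · rw [habs]
    refine cfc_congr fun z _ => ?_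
    by_cases hz : z = 0
    · simp [hz]
    · have h : (√‖z‖ : ℂ) ≠ 0 := by simpa using hz
      have h2 : (√‖z‖ : ℂ) * √‖z‖ = ‖z‖ := by simp [← Complex.ofReal_mul]
      have h3 : star z * z = (√‖z‖ * √‖z‖ : ℂ) * (√‖z‖ * √‖z‖ : ℂ) := by
        rw [h2, Complex.star_def, Complex.conj_mul', sq]
      rw [star_div₀, Complex.star_def, Complex.conj_ofReal, div_mul_div_comm,
        ← Complex.star_def, h3, ← h2]
      field_simp
  · conv_rhs => rw [← cfc_id' ℂ A]
    refine cfc_congr fun z _ => ?_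
    by_cases hz : z = 0
    · simp [hz]
    · have h : (√‖z‖ : ℂ) ≠ 0 := by simpa using hz
      rw [Complex.star_def, Complex.conj_ofReal, mul_div_cancel₀ _ h]

end Main

theorem corollary2p4 (n : ℕ) (A : Matrix (Fin n) (Fin n) ℂ) (hA : IsStarNormal A) :
    WeakLogMajorisedBy (matrixAbs (entrywiseRealPart A)) (entrywiseRealPart (matrixAbs A)) ∧
      ((‖(entrywiseRealPart A).det‖ : ℝ) : ℂ) ≤ (entrywiseRealPart (matrixAbs A)).det := by
  obtain ⟨S, T, hS, hT, hST⟩ := exists_factorisation_of_isStarNormal A hA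
  obtain ⟨F, G, hF, hG, hFG⟩ := exists_gram_entrywiseRealPart hS hT hST
  exact ⟨weakLogMajorisedBy_of_gram hF hG hFG, norm_det_le_det_of_gram hF hG hFG⟩
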